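/- **Coloring.** Let $|\cdot|_2$ be any extension to $\mathbb{R}$ of the 2-adic valuation of $\mathbb{Q}$: a function $\mathbb{R}\to[0,\infty)$ with $|x|_2=0\iff x=0$, $|xy|_2=|x|_2|y|_2$, $|x+y|_2\le\max\{|x|_2,|y|_2\}$, and $|2^m r/s|_2=2^{-m}$ for $m\in\mathbb{Z}$ and odd integers $r,s$. Color a point $(x,y)\in\mathbb{R}^2$ red, green or blue according to whether the first entry of $(|x|_2,|y|_2,1)$ equal to $\max\{|x|_2,|y|_2,1\}$ is the first, second or third entry. **Polygons and dissections.** A simple polygon is a compact set $P\subset\mathbb{R}^2$ whose boundary is a simple closed curve formed by finitely many line segments; its sides are the maximal line segments on the boundary, and its corners are the endpoints of the sides. A side is red-blue if one of its endpoints is red and the other is blue. A dissection $D$ of $P$ into $n$ triangles is a set of $n$ (nondegenerate) triangles with pairwise disjoint interiors whose union is $P$. The nodes of its skeleton graph $G$ are the corners of the triangles of $D$; two distinct nodes are joined by an edge if they lie on the same side of a triangle of $D$ and the segment joining them contains no other node. The faces of $G$ are the triangular faces (the boundary cycles of the triangles of $D$) and the outside face (the boundary cycle of $P$); their sides are the sides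 of the triangles and of $P$, respectively. **Maps.** A constrained framed map of $G$ is a map $\phi$ from the set of nodes of $G$ to $\mathbb{R}^2$ that fixes every corner of $P$ and such that, for every side of every face of $G$ (including the outside face), the images under $\phi$ of all nodes lying on that side, endpoints included, lie on a common line. The signed area with respect to $\phi$ of the triangular face with corners $c_1,c_2,c_3$, labeled counterclockwise in $D$, is $$a_\phi=\frac12\begin{vmatrix}1&1&1\\ x_1&x_2&x_3\\ y_1&y_2&y_3\end{vmatrix},\qquad (x_i,y_i)=\phi(c_i).$$ **Theorem.** Let $P$ be a simple polygon of integer area $E$ with an odd number of red-blue sides, let $D$ be a dissection of $P$ into an odd number $n$ of triangles, and let $\phi$ be a constrained framed map of the skeleton graph of $D$. Then some triangular face of the skeleton graph has signed area with respect to $\phi$ different from $E/n$. -/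

import Mathlib

open scoped NNReal

namespace FramedMonsky

/-- The Euclidean plane. -/
abbrev Plane : Type := EuclideanSpace ℝ (Fin 2)

/-! ### Simple polygons -/

/-- `P` is a simple polygon whose corners, listed in cyclic order along the boundary, are the
vertices of `B`. So `P` is compact and its boundary is the closed polygonal curve `B`.
The curve does not turn straight at a corner (three consecutive corners are not collinear, so that
the edges `B.edgeSet ℝ j` are exactly the maximal line segments on the boundary, the sides), and it
does not meet itself: the edges, each taken without its final endpoint, are pairwise disjoint. -/
structure IsSimplePolygon {k : ℕ} [NeZero k] (P : Set Plane) (B : Polygon Plane k) : Prop where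
  isCompact : IsCompact P
  frontier_eq : frontier P = B.boundary ℝ
  corners : B.HasNondegenerateVertices ℝ
  simple : Pairwise fun i j : Fin k =>
    Disjoint (B.edgePath ℝ i '' Set.Ico (0 : ℝ) 1) (B.edgePath ℝ j '' Set.Ico (0 : ℝ) 1)

/-! ### Dissections and their skeleton graphs -/

/-- The signed area of the triangle with corners `p 0`, `p 1`, `p 2`. -/
noncomputable def signedArea (p : Fin 3 → Plane) : ℝ :=
  1 / 2 * Matrix.det !![1, 1, 1; p 0 0, p 1 0, p 2 0; p 0 1, p 1 1, p 2 1]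

/-- A dissection of `P` into `n` triangles: (nondegenerate) triangles with pairwise disjoint
interiors whose union is `P`. The corners of each triangle are labeled counterclockwise. -/
structure Dissection (P : Set Plane) (n : ℕ) where
  triangle : Fin n → Affine.Triangle ℝ Plane
  counterclockwise : ∀ i, 0 < signedArea (triangle i).points
  disjoint_interiors : Pairwise fun i j : Fin n =>
    Disjoint (interior (convexHull ℝ (Set.range (triangle i).points)))
      (interior (convexHull ℝ (Set.range (triangle j).points)))
  cover : ⋃ i, convexHull ℝ (Set.range (triangle i).points) = P

namespace Dissection

variable {P : Set Plane} {n : ℕ}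

/-- The nodes of the skeleton graph: the corners of the triangles. -/
def nodes (D : Dissection P n) : Set Plane :=
  ⋃ i, Set.range (D.triangle i).points

/-- The corner `a` of the `i`-th triangle, as a node. -/
def corner (D : Dissection P n) (i : Fin n) (a : Fin 3) : D.nodes :=
  ⟨(D.triangle i).points a, Set.mem_iUnion.2 ⟨i, Set.mem_range_self a⟩⟩

/-- The skeleton graph: two nodes are joined by an edge if they lie on the same side of a triangle
and the segment joining them contains no other node. Its vertex type is `D.nodes`; its triangular
faces are the triangles of `D`, with their nodes, and its outside face is the boundary of `P`. -/
def skeletonGraph (D : Dissection P n) : SimpleGraph D.nodes where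
  Adj u v := u ≠ v ∧
    (∃ (i : Fin n) (a b : Fin 3), a ≠ b ∧
      (u : Plane) ∈ segment ℝ ((D.triangle i).points a) ((D.triangle i).points b) ∧
      (v : Plane) ∈ segment ℝ ((D.triangle i).points a) ((D.triangle i).points b)) ∧
    ∀ w : D.nodes, (w : Plane) ∈ segment ℝ (u : Plane) (v : Plane) → w = u ∨ w = v
  symm := ⟨by
    rintro u v ⟨hne, ⟨i, a, b, hab, hu, hv⟩, h⟩
    refine ⟨hne.symm, ⟨i, a, b, hab, hv, hu⟩, fun w hw => ?_⟩
    rw [segment_symm] at hw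
    exact (h w hw).symm⟩
  loopless := ⟨fun _ h => h.1 rfl⟩

/-- The nodes of the skeleton graph that lie on a subset `s` of the plane. If `s` is a side of a
face (a triangle of `D`, or the outside face), these are the two corners of that side together
with the side nodes on it. -/
def nodesOn (D : Dissection P n) (s : Set Plane) : Set D.nodes :=
  {v | (v : Plane) ∈ s}

/-- A framed map of the skeleton graph sends each corner of `P` to itself. -/
def IsFramedMap {k : ℕ} (D : Dissection P n) (B : Polygon Plane k) (φ : D.nodes → Plane) : Prop :=
  ∀ v : D.nodes, (v : Plane) ∈ Set.range B.vertices → φ v = v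

/-- A framed map is constrained if for every side of every face, including the outside face, it
sends all the nodes on that side to a line. -/
structure IsConstrainedFramedMap {k : ℕ} (D : Dissection P n) (B : Polygon Plane k)
    (φ : D.nodes → Plane) : Prop where
  framed : D.IsFramedMap B φ
  triangular_faces : ∀ (i : Fin n) (a b : Fin 3), a ≠ b →
    Collinear ℝ (φ '' D.nodesOn (segment ℝ ((D.triangle i).points a) ((D.triangle i).points b)))
  outside_face : ∀ j : Fin k, Collinear ℝ (φ '' D.nodesOn (B.edgeSet ℝ j))

/-- The signed area of the `i`-th triangular face with respect to `φ`. -/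
noncomputable def faceArea (D : Dissection P n) (φ : D.nodes → Plane) (i : Fin n) : ℝ :=
  signedArea fun a => φ (D.corner i a)

end Dissection

/-! ### The coloring of the plane -/

/-- `v` is an extension to `ℝ` of the 2-adic valuation of `ℚ`, written multiplicatively. -/
def IsTwoAdic (v : Valuation ℝ ℝ≥0) : Prop :=
  ∀ q : ℚ, (v (q : ℝ) : ℝ) = ((padicNorm 2 q : ℚ) : ℝ)

inductive Color : Type
  | red
  | green
  | blue

/-- The color of `(x, y)` tells which entry of `(v x, v y, 1)` is the first one to attain the
maximum of the three. -/
noncomputable def color (v : Valuation ℝ ℝ≥0) (p : Plane) : Color :=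
  if v (p 0) = max (max (v (p 0)) (v (p 1))) 1 then Color.red
  else if v (p 1) = max (max (v (p 0)) (v (p 1))) 1 then Color.green
  else Color.blue

/-- The `j`-th side has one red and one blue endpoint. -/
def IsRedBlueSide {k : ℕ} (v : Valuation ℝ ℝ≥0) (B : Polygon Plane k) (j : Fin k) : Prop :=
  (color v (B j) = Color.red ∧ color v (B (finRotate k j)) = Color.blue) ∨
    (color v (B j) = Color.blue ∧ color v (B (finRotate k j)) = Color.red)

end FramedMonsky

namespace FramedMonsky

open Filter Topology

/-! The proof is Monsky's valuation argument combined with a Sperner-type parity count, carried out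
on the images of the nodes under the framed map.

If `p`, `q`, `r` are red, green and blue, one term of the determinant `cross p q r` strictly
dominates all others, so its valuation is at least 1 (`one_le_valuation_cross`). Two consequences
follow. No line carries all three colors. And a rainbow face cannot have signed area `E / n`: twice
that number has valuation less than 1, since `n` is odd and `E` is an integer. It therefore suffices
to find a face whose corners have rainbow images.

On a line some color is missing, which makes the red-blue indicator modulo 2 a coboundary `g x + g
y` (`exists_redBlue_eq_add`). Hence its value on the two ends of a side of a face is the sum over
consecutive nodes of that side, even if the map folds the side or permutes its nodes along the image
line. Each segment between neighboring nodes lies on an even number of sides of faces, the outside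
face included (`sum_sides_eq_sum_edges`), so the sum over all triangular faces equals the sum over
the polygon. Corners of the polygon are nodes (`vertices_mem_nodes`) and are fixed, so the latter
sum is the parity of the number of red-blue sides, namely 1. Some face then has an odd number of
red-blue sides, and such a face is rainbow. -/

/-- Twice the signed area of the triangle with corners `p`, `q`, `r`. -/
def cross (p q r : Plane) : ℝ :=
  (q 0 - p 0) * (r 1 - p 1) - (q 1 - p 1) * (r 0 - p 0)

lemma signedArea_eq_cross (p : Fin 3 → Plane) :
    signedArea p = 1 / 2 * cross (p 0) (p 1) (p 2) := by
  simp [signedArea, cross, Matrix.det_fin_three]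
  ring

lemma cross_eq_zero_of_collinear {s : Set Plane} (hs : Collinear ℝ s) {p q r : Plane}
    (hp : p ∈ s) (hq : q ∈ s) (hr : r ∈ s) : cross p q r = 0 := by
  obtain ⟨d, hd⟩ := (collinear_iff_of_mem hp).1 hs
  obtain ⟨a, rfl⟩ := hd q hq
  obtain ⟨b, rfl⟩ := hd r hr
  simp [cross]
  ring

/-! ### Rainbow triangles -/

section Coloring

variable {v : Valuation ℝ ℝ≥0}

lemma color_eq_red_iff {p : Plane} :
    color v p = Color.red ↔ v (p 1) ≤ v (p 0) ∧ 1 ≤ v (p 0) := by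
  unfold color
  split_ifs with h1 h2
  · simp only [true_iff]
    rw [h1]; simp
  · simp only [false_iff]
    rintro ⟨h, h'⟩
    exact h1 (by simp [h, h'])
  · simp only [false_iff]
    rintro ⟨h, h'⟩
    exact h1 (by simp [h, h'])

lemma color_eq_green_iff {p : Plane} :
    color v p = Color.green ↔ v (p 0) < v (p 1) ∧ 1 ≤ v (p 1) := by
  unfold color
  split_ifs with h1 h2
  · simp only [false_iff]
    rintro ⟨h, h'⟩
    rw [max_eq_right h.le, max_eq_left h'] at h1
    exact h.ne h1
  · simp only [true_iff]
    have h3 : v (p 0) ≤ v (p 1) := by rw [h2]; simp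
    have h4 : 1 ≤ v (p 1) := by rw [h2]; simp
    refine ⟨lt_of_le_of_ne h3 fun h => h1 (h.trans h2), h4⟩
  · simp only [false_iff]
    rintro ⟨h, h'⟩
    exact h2 (by simp [h.le, h'])

lemma color_eq_blue_iff {p : Plane} :
    color v p = Color.blue ↔ v (p 0) < 1 ∧ v (p 1) < 1 := by
  have hr := color_eq_red_iff (v := v) (p := p)
  have hg := color_eq_green_iff (v := v) (p := p)
  cases hc : color v p <;> simp only [hc, reduceCtorEq, true_iff, false_iff] at hr hg ⊢
  · exact fun h => hr.2.not_gt h.1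
  · exact fun h => hg.2.not_gt h.2
  · constructor <;> by_contra! h
    · exact hr ⟨not_lt.1 fun h' => hg ⟨h', h.trans h'.le⟩, h⟩
    · exact hg ⟨not_le.1 fun h' => hr ⟨h', h.trans h'⟩, h⟩

/-- Among the six products in the determinant, `p 0 * q 1` has strictly the largest valuation, so by
the ultrametric inequality the whole determinant has the valuation of that product. -/
lemma one_le_valuation_cross {p q r : Plane} (hp : color v p = Color.red)
    (hq : color v q = Color.green) (hr : color v r = Color.blue) : 1 ≤ v (cross p q r) := by
  obtain ⟨hp1, hp2⟩ := color_eq_red_iff.1 hp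
  obtain ⟨hq1, hq2⟩ := color_eq_green_iff.1 hq
  obtain ⟨hr1, hr2⟩ := color_eq_blue_iff.1 hr
  have hp0 : 0 < v (p 0) := zero_lt_one.trans_le hp2
  have hq0 : 0 < v (q 1) := zero_lt_one.trans_le hq2
  have e1 : v (p 1 * q 0) < v (p 0 * q 1) := by
    rw [map_mul, map_mul]
    exact (mul_le_mul_left hp1 _).trans_lt (mul_lt_mul_of_pos_left hq1 hp0)
  have e2 : v (q 0 * r 1) < v (p 0 * q 1) := by
    rw [map_mul, map_mul]
    calc v (q 0) * v (r 1) ≤ v (q 0) * 1 := by gcongr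
      _ < v (q 1) * 1 := by gcongr
      _ ≤ v (q 1) * v (p 0) := by gcongr
      _ = _ := mul_comm _ _
  have e3 : v (q 1 * r 0) < v (p 0 * q 1) := by
    rw [map_mul, map_mul, mul_comm (v (p 0))]
    exact mul_lt_mul_of_pos_left (hr1.trans_le hp2) hq0
  have e4 : v (p 0 * r 1) < v (p 0 * q 1) := by
    rw [map_mul, map_mul]
    exact mul_lt_mul_of_pos_left (hr2.trans_le hq2) hp0
  have e5 : v (p 1 * r 0) < v (p 0 * q 1) := by
    rw [map_mul, map_mul]
    calc v (p 1) * v (r 0) ≤ v (p 0) * v (r 0) := by gcongr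
      _ < v (p 0) * v (q 1) := mul_lt_mul_of_pos_left (hr1.trans_le hq2) hp0
  have hsplit : cross p q r =
      (-(p 1 * q 0) + q 0 * r 1 + -(q 1 * r 0) + -(p 0 * r 1) + p 1 * r 0) + p 0 * q 1 := by
    simp only [cross]; ring
  have hlt : v (-(p 1 * q 0) + q 0 * r 1 + -(q 1 * r 0) + -(p 0 * r 1) + p 1 * r 0)
      < v (p 0 * q 1) := by
    refine v.map_add_lt (v.map_add_lt (v.map_add_lt (v.map_add_lt ?_ e2) ?_) ?_) e5 <;>
      rwa [v.map_neg]
  rw [hsplit, v.map_add_eq_of_lt_right hlt, map_mul]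
  exact one_le_mul hp2 hq2

lemma one_le_valuation_cross_of_rainbow {p : Fin 3 → Plane}
    (h : ∀ c, ∃ a, color v (p a) = c) : 1 ≤ v (cross (p 0) (p 1) (p 2)) := by
  obtain ⟨a, ha⟩ := h Color.red
  obtain ⟨b, hb⟩ := h Color.green
  obtain ⟨c, hc⟩ := h Color.blue
  have key := one_le_valuation_cross ha hb hc
  have hab : a ≠ b := by rintro rfl; simp [ha] at hb
  have hac : a ≠ c := by rintro rfl; simp [ha] at hc
  have hbc : b ≠ c := by rintro rfl; simp [hb] at hc
  have : cross (p a) (p b) (p c) = cross (p 0) (p 1) (p 2) ∨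
      cross (p a) (p b) (p c) = -cross (p 0) (p 1) (p 2) := by
    -- A permutation of the corners changes the determinant at most by a sign, which the valuation
    -- ignores.
    clear ha hb hc key
    fin_cases a <;> fin_cases b <;> fin_cases c <;> simp_all [cross] <;>
      first
        | (left; ring1)
        | (right; ring1)
  rcases this with h | h <;> rw [h] at key
  · exact key
  · rwa [v.map_neg] at key

/-- The indicator modulo 2 of a red-blue pair. -/
def redBlue : Color → Color → ZMod 2
  | Color.red, Color.blue => 1
  | Color.blue, Color.red => 1
  | _, _ => 0

/-- A triangle that misses a color has zero or two red-blue sides. The indices `a + 1`, `a + 2` name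
the side opposite to `a`. -/
lemma rainbow_of_sum_redBlue_ne_zero {c : Fin 3 → Color}
    (h : ∑ a, redBlue (c (a + 1)) (c (a + 2)) ≠ 0) : Function.Surjective c := by
  rw [Fin.sum_univ_three] at h
  have hc : c = ![c 0, c 1, c 2] := List.ofFn_inj.mp rfl
  simp only [zero_add, show (1 : Fin 3) + 1 = 2 from rfl, show (1 : Fin 3) + 2 = 0 from rfl,
    show (2 : Fin 3) + 1 = 0 from rfl, show (2 : Fin 3) + 2 = 1 from rfl] at h
  intro d
  by_contra! hd
  have h0 := hd 0
  have h1 := hd 1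
  have h2 := hd 2
  revert h h0 h1 h2
  cases c 0 <;> cases c 1 <;> cases c 2 <;> cases d <;> simp [redBlue] <;> decide

/-- On a line, being a red-blue pair is a coboundary modulo 2. -/
lemma exists_redBlue_eq_add {s : Set Plane} (hs : Collinear ℝ s) :
    ∃ g : Plane → ZMod 2, ∀ x ∈ s, ∀ y ∈ s,
      redBlue (color v x) (color v y) = g x + g y := by
  by_cases hr : ∃ x ∈ s, color v x = Color.red
  · by_cases hb : ∃ x ∈ s, color v x = Color.blue
    · have hg : ∀ x ∈ s, color v x ≠ Color.green := by
        intro q hq hq'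
        obtain ⟨p, hp, hp'⟩ := hr
        obtain ⟨r, hr, hr'⟩ := hb
        have := one_le_valuation_cross hp' hq' hr'
        rw [cross_eq_zero_of_collinear hs hp hq hr, map_zero] at this
        exact absurd this (by simp)
      -- Only red and blue occur here, so a pair is red-blue exactly when one of the two is red; `g`
      -- is the indicator of red.
      refine ⟨fun x => redBlue Color.blue (color v x), fun x hx y hy => ?_⟩
      have h1 := hg x hx
      have h2 := hg y hy
      dsimp only
      revert h1 h2
      cases color v x <;> cases color v y <;> simp [redBlue]
      decide
    · push Not at hb
      -- Without blue points no pair is red-blue, and `g = 0` works; the same holds below without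
      -- red points.
      refine ⟨0, fun x hx y hy => ?_⟩
      have h1 := hb x hx
      have h2 := hb y hy
      revert h1 h2
      cases color v x <;> cases color v y <;> simp [redBlue]
  · push Not at hr
    refine ⟨0, fun x hx y hy => ?_⟩
    have h1 := hr x hx
    have h2 := hr y hy
    revert h1 h2
    cases color v x <;> cases color v y <;> simp [redBlue]

/-- An odd `n` is a 2-adic unit, so dividing by it keeps an integer 2-adically integral. -/
lemma IsTwoAdic.valuation_div_le_one (hv : IsTwoAdic v) {E : ℤ} {n : ℕ} (hn : Odd n) :
    v ((E : ℝ) / (n : ℝ)) ≤ 1 := by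
  have h := hv ((E : ℚ) / (n : ℚ))
  rw [padicNorm.div, show ((n : ℕ) : ℚ) = ((n : ℤ) : ℚ) by simp,
    (padicNorm.int_eq_one_iff (p := 2) (n : ℤ)).2 (by
      have := hn.not_two_dvd_nat; exact_mod_cast this), div_one] at h
  have h1 : padicNorm 2 (E : ℚ) ≤ 1 := padicNorm.of_int E
  push_cast at h
  rw [← NNReal.coe_le_coe, h, NNReal.coe_one, ← Rat.cast_one, Rat.cast_le]
  exact h1

lemma IsTwoAdic.valuation_two_lt_one (hv : IsTwoAdic v) : v 2 < 1 := by
  have h := hv 2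
  rw [show (2 : ℚ) = ((2 : ℕ) : ℚ) by simp, padicNorm.padicNorm_p one_lt_two] at h
  rw [← NNReal.coe_lt_coe]
  push_cast at h ⊢
  rw [h]; norm_num

/-- A rainbow triangle does not have the area `E / n` when `E` is an integer and `n` is odd. -/
lemma IsTwoAdic.signedArea_ne_of_rainbow (hv : IsTwoAdic v) {E : ℤ} {n : ℕ} (hn : Odd n)
    {p : Fin 3 → Plane} (h : ∀ c, ∃ a, color v (p a) = c) :
    signedArea p ≠ (E : ℝ) / (n : ℝ) := by
  intro he
  have h1 := one_le_valuation_cross_of_rainbow h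
  rw [signedArea_eq_cross] at he
  rw [show cross (p 0) (p 1) (p 2) = 2 * ((E : ℝ) / n) by rw [← he]; ring, map_mul] at h1
  have := mul_lt_one_of_lt_of_le hv.valuation_two_lt_one (hv.valuation_div_le_one (E := E) hn)
  exact this.not_ge h1

end Coloring

/-! ### Elementary pairs of a finite set of points -/

section Elementary

variable {V : Type*} [AddCommGroup V] [Module ℝ V]

open Classical in
/-- The pairs of distinct points of `N`, each listed in one order, whose segment contains no other
point of `N`. -/
noncomputable def elementaryPairs (N : Finset V) : Finset (V × V) :=
  (N ×ˢ N).filter fun e => WellOrderingRel e.1 e.2 ∧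
    ∀ w ∈ N, w ∈ segment ℝ e.1 e.2 → w = e.1 ∨ w = e.2

lemma mem_elementaryPairs {N : Finset V} {e : V × V} :
    e ∈ elementaryPairs N ↔ (e.1 ∈ N ∧ e.2 ∈ N) ∧ WellOrderingRel e.1 e.2 ∧
      ∀ w ∈ N, w ∈ segment ℝ e.1 e.2 → w = e.1 ∨ w = e.2 := by
  classical
  simp [elementaryPairs]

lemma ne_of_mem_elementaryPairs {N : Finset V} {e : V × V} (he : e ∈ elementaryPairs N) :
    e.1 ≠ e.2 := fun h => by
  have := (mem_elementaryPairs.1 he).2.1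
  rw [h] at this
  exact irrefl _ this

/-- A point of a segment splits it into two halves; any two points of the segment lie in the same
half or have the splitting point between them. -/
lemma mem_segment_split {a b c u w : V} (hc : c ∈ segment ℝ a b)
    (hu : u ∈ segment ℝ a b) (hw : w ∈ segment ℝ a b) :
    (u ∈ segment ℝ a c ∧ w ∈ segment ℝ a c) ∨ (u ∈ segment ℝ c b ∧ w ∈ segment ℝ c b) ∨
      c ∈ segment ℝ u w := by
  rw [segment_eq_image_lineMap] at hc hu hw
  obtain ⟨t, ⟨ht0, ht1⟩, rfl⟩ := hc
  obtain ⟨x, ⟨hx0, hx1⟩, rfl⟩ := hu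
  obtain ⟨y, ⟨hy0, hy1⟩, rfl⟩ := hw
  have key : ∀ {r s z : ℝ}, z ∈ segment ℝ r s → AffineMap.lineMap a b z ∈
      segment ℝ (AffineMap.lineMap a b r : V) (AffineMap.lineMap a b s) := by
    intro r s z hz
    rw [← image_segment]
    exact Set.mem_image_of_mem _ hz
  have hL : ∀ {z : ℝ}, 0 ≤ z → z ≤ t →
      AffineMap.lineMap a b z ∈ segment ℝ a (AffineMap.lineMap a b t : V) := by
    intro z h0 h1
    have := key (r := 0) (s := t) (z := z) (by rw [segment_eq_Icc ht0]; exact ⟨h0, h1⟩)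
    rwa [AffineMap.lineMap_apply_zero] at this
  have hR : ∀ {z : ℝ}, t ≤ z → z ≤ 1 →
      AffineMap.lineMap a b z ∈ segment ℝ (AffineMap.lineMap a b t : V) b := by
    intro z h0 h1
    have := key (r := t) (s := 1) (z := z) (by rw [segment_eq_Icc ht1]; exact ⟨h0, h1⟩)
    rwa [AffineMap.lineMap_apply_one] at this
  rcases le_total x t with hx | hx <;> rcases le_total y t with hy | hy
  · exact Or.inl ⟨hL hx0 hx, hL hy0 hy⟩
  · exact Or.inr (Or.inr (key (by rw [segment_eq_Icc (hx.trans hy)]; exact ⟨hx, hy⟩)))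
  · exact Or.inr (Or.inr (key (by
      rw [segment_symm, segment_eq_Icc (hy.trans hx)]; exact ⟨hy, hx⟩)))
  · exact Or.inr (Or.inl ⟨hR hx hx1, hR hy hy1⟩)

lemma eq_of_mem_segment_of_mem_segment {a b c u : V} (hc : c ∈ segment ℝ a b)
    (h1 : u ∈ segment ℝ a c) (h2 : u ∈ segment ℝ c b) : u = c := by
  rw [mem_segment_iff_wbtw] at hc h1 h2
  exact (wbtw_swap_left_iff ℝ b).1 ⟨h2, hc.trans_left_right h1⟩ |>.symm

open Classical in
/-- A coboundary modulo 2 telescopes along a segment. -/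
lemma sum_elementaryPairs {N : Finset V} (g : V → ZMod 2) {a b : V} (ha : a ∈ N) (hb : b ∈ N) :
    ∑ e ∈ elementaryPairs N,
      (if e.1 ∈ segment ℝ a b ∧ e.2 ∈ segment ℝ a b then g e.1 + g e.2 else 0) = g a + g b := by
  induction hm : (N.filter (· ∈ segment ℝ a b)).card using Nat.strong_induction_on
    generalizing a b with
  | _ m ih =>
    subst hm
    -- An intermediate point `c` cuts the segment into two halves with fewer points of `N` each; `g
    -- c` occurs twice and cancels modulo 2.
    by_cases hex : ∃ c ∈ N, c ∈ segment ℝ a b ∧ c ≠ a ∧ c ≠ b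
    · obtain ⟨c, hcN, hc, hca, hcb⟩ := hex
      have hsL : segment ℝ a c ⊆ segment ℝ a b :=
        (convex_segment a b).segment_subset (left_mem_segment ℝ a b) hc
      have hsR : segment ℝ c b ⊆ segment ℝ a b :=
        (convex_segment a b).segment_subset hc (right_mem_segment ℝ a b)
      have hL := ih _ (Finset.card_lt_card (by
        rw [Finset.ssubset_iff_of_subset
          (Finset.monotone_filter_right N fun x _ hx => hsL hx)]
        refine ⟨b, by simp [hb, right_mem_segment], fun h => hcb ?_⟩
        exact (eq_of_mem_segment_of_mem_segment hc (Finset.mem_filter.1 h).2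
          (right_mem_segment ℝ c b)).symm)) ha hcN rfl
      have hR := ih _ (Finset.card_lt_card (by
        rw [Finset.ssubset_iff_of_subset
          (Finset.monotone_filter_right N fun x _ hx => hsR hx)]
        refine ⟨a, by simp [ha, left_mem_segment], fun h => hca ?_⟩
        exact (eq_of_mem_segment_of_mem_segment hc (left_mem_segment ℝ a c)
          (Finset.mem_filter.1 h).2).symm)) hcN hb rfl
      have hsum : g a + g b = (g a + g c) + (g c + g b) := by
        have : g c + g c = 0 := CharTwo.add_self_eq_zero _
        linear_combination -this
      rw [hsum, ← hL, ← hR, ← Finset.sum_add_distrib]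
      refine Finset.sum_congr rfl fun e he => ?_
      have hne := ne_of_mem_elementaryPairs he
      obtain ⟨-, -, hel⟩ := mem_elementaryPairs.1 he
      have hdisj : ¬ ((e.1 ∈ segment ℝ a c ∧ e.2 ∈ segment ℝ a c) ∧
          (e.1 ∈ segment ℝ c b ∧ e.2 ∈ segment ℝ c b)) := fun h =>
        hne ((eq_of_mem_segment_of_mem_segment hc h.1.1 h.2.1).trans
          (eq_of_mem_segment_of_mem_segment hc h.1.2 h.2.2).symm)
      have hiff : (e.1 ∈ segment ℝ a b ∧ e.2 ∈ segment ℝ a b) ↔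
          ((e.1 ∈ segment ℝ a c ∧ e.2 ∈ segment ℝ a c) ∨
          (e.1 ∈ segment ℝ c b ∧ e.2 ∈ segment ℝ c b)) := by
        constructor
        · rintro ⟨h1, h2⟩
          rcases mem_segment_split hc h1 h2 with h | h | h
          · exact Or.inl h
          · exact Or.inr h
          -- An elementary pair has no further point of `N` on its segment, so `c` is one of its
          -- ends and the pair lies in one half.
          · rcases hel c hcN h with h' | h'
            · rw [← h'] at h1 ⊢
              rcases mem_segment_split hc h2 h2 with h | h | h
              · exact Or.inl ⟨right_mem_segment ℝ a c, h.1⟩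
              · exact Or.inr ⟨left_mem_segment ℝ c b, h.1⟩
              · rw [segment_same] at h
                exact absurd (h'.symm.trans h) hne
            · rw [← h'] at h2 ⊢
              rcases mem_segment_split hc h1 h1 with h | h | h
              · exact Or.inl ⟨h.1, right_mem_segment ℝ a c⟩
              · exact Or.inr ⟨h.1, left_mem_segment ℝ c b⟩
              · rw [segment_same] at h
                exact absurd (h.symm.trans h') hne
        · rintro (⟨h1, h2⟩ | ⟨h1, h2⟩)
          · exact ⟨hsL h1, hsL h2⟩
          · exact ⟨hsR h1, hsR h2⟩
      simp only [hiff]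
      by_cases h1 : e.1 ∈ segment ℝ a c ∧ e.2 ∈ segment ℝ a c
      · have h2 : ¬ (e.1 ∈ segment ℝ c b ∧ e.2 ∈ segment ℝ c b) := fun h => hdisj ⟨h1, h⟩
        rw [if_pos (Or.inl h1), if_pos h1, if_neg h2, add_zero]
      · rw [if_neg h1, zero_add]
        simp only [h1, false_or]
    · push Not at hex
      have hends : ∀ e ∈ elementaryPairs N, e.1 ∈ segment ℝ a b ∧ e.2 ∈ segment ℝ a b →
          e = (a, b) ∨ e = (b, a) := by
        intro e he ⟨h1, h2⟩
        have hne := ne_of_mem_elementaryPairs he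
        obtain ⟨⟨hN1, hN2⟩, -, -⟩ := mem_elementaryPairs.1 he
        have h1' : e.1 = a ∨ e.1 = b := or_iff_not_imp_left.2 (hex _ hN1 h1)
        have h2' : e.2 = a ∨ e.2 = b := or_iff_not_imp_left.2 (hex _ hN2 h2)
        rcases h1' with h1' | h1' <;> rcases h2' with h2' | h2'
        · exact absurd (h1'.trans h2'.symm) hne
        · exact Or.inl (Prod.ext h1' h2')
        · exact Or.inr (Prod.ext h1' h2')
        · exact absurd (h1'.trans h2'.symm) hne
      have hord : ∀ {x y : V}, x ∈ N → y ∈ N → WellOrderingRel x y →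
          (x = a ∧ y = b ∨ x = b ∧ y = a) →
          ∑ e ∈ elementaryPairs N,
            (if e.1 ∈ segment ℝ a b ∧ e.2 ∈ segment ℝ a b then g e.1 + g e.2 else 0) =
          g x + g y := by
        intro x y hx hy hxy hab
        have hseg : segment ℝ x y = segment ℝ a b := by
          rcases hab with ⟨rfl, rfl⟩ | ⟨rfl, rfl⟩
          · rfl
          · exact segment_symm ℝ _ _
        have hmem : (x, y) ∈ elementaryPairs N := by
          refine mem_elementaryPairs.2 ⟨⟨hx, hy⟩, hxy, fun w hw hws => ?_⟩
          have hws' : w ∈ segment ℝ a b := hseg ▸ hws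
          have := hex w hw hws'
          rcases hab with ⟨rfl, rfl⟩ | ⟨rfl, rfl⟩ <;> tauto
        rw [Finset.sum_eq_single_of_mem _ hmem]
        · rw [if_pos ⟨hseg ▸ left_mem_segment ℝ x y, hseg ▸ right_mem_segment ℝ x y⟩]
        · intro e he hne
          refine if_neg fun h => ?_
          have hrel := (mem_elementaryPairs.1 he).2.1
          have hyx : e ≠ (y, x) := by
            rintro rfl
            exact asymm hrel hxy
          rcases hends e he h with h' | h' <;>
            rcases hab with ⟨rfl, rfl⟩ | ⟨rfl, rfl⟩ <;> contradiction
      -- With no intermediate point only the pair of ends contributes, listed in whichever order the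
      -- well-ordering selects; for `a = b` both sides vanish.
      rcases trichotomous_of WellOrderingRel a b with h | h | h
      · exact hord ha hb h (Or.inl ⟨rfl, rfl⟩)
      · subst h
        rw [CharTwo.add_self_eq_zero]
        refine Finset.sum_eq_zero fun e he => if_neg fun h => ?_
        have := ne_of_mem_elementaryPairs he
        rcases hends e he h with rfl | rfl <;> exact this rfl
      · rw [add_comm]
        exact hord hb ha h (Or.inr ⟨rfl, rfl⟩)

end Elementary

/-! ### Lines in the plane -/

lemma cross_swap (p q r : Plane) : cross q p r = -cross p q r := by
  simp only [cross]; ring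

lemma cross_left (p q : Plane) : cross p q p = 0 := by simp [cross]

lemma cross_right (p q : Plane) : cross p q q = 0 := by simp [cross]; ring

lemma cross_lineMap (p q u w : Plane) (t : ℝ) :
    cross p q (AffineMap.lineMap u w t) = (1 - t) * cross p q u + t * cross p q w := by
  simp [cross, AffineMap.lineMap_apply]; ring

lemma coord_sub_sq_pos {p q : Plane} (h : p ≠ q) :
    0 < (q 0 - p 0) ^ 2 + (q 1 - p 1) ^ 2 := by
  by_contra! hle
  have h0 : q 0 - p 0 = 0 := by nlinarith [sq_nonneg (q 0 - p 0), sq_nonneg (q 1 - p 1)]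
  have h1 : q 1 - p 1 = 0 := by nlinarith [sq_nonneg (q 0 - p 0), sq_nonneg (q 1 - p 1)]
  refine h (PiLp.ext fun i => ?_)
  fin_cases i
  · simpa using (sub_eq_zero.1 h0).symm
  · simpa using (sub_eq_zero.1 h1).symm

lemma exists_lineMap_of_cross_eq_zero {p q r : Plane} (hpq : p ≠ q) (h : cross p q r = 0) :
    ∃ t : ℝ, AffineMap.lineMap p q t = r := by
  have hpos := coord_sub_sq_pos hpq
  -- The parameter is that of the orthogonal projection of `r` to the line through `p` and `q`.
  refine ⟨((r 0 - p 0) * (q 0 - p 0) + (r 1 - p 1) * (q 1 - p 1)) /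
    ((q 0 - p 0) ^ 2 + (q 1 - p 1) ^ 2), PiLp.ext fun i => ?_⟩
  unfold cross at h
  fin_cases i
  · simp only [AffineMap.lineMap_apply, Fin.zero_eta, vsub_eq_sub, vadd_eq_add, PiLp.add_apply,
      PiLp.smul_apply, PiLp.sub_apply, smul_eq_mul]
    rw [div_mul_eq_mul_div, div_add' _ _ _ hpos.ne', div_eq_iff hpos.ne']
    linear_combination (q 1 - p 1) * h
  · simp only [AffineMap.lineMap_apply, Fin.mk_one, vsub_eq_sub, vadd_eq_add, PiLp.add_apply,
      PiLp.smul_apply, PiLp.sub_apply, smul_eq_mul]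
    rw [div_mul_eq_mul_div, div_add' _ _ _ hpos.ne', div_eq_iff hpos.ne']
    linear_combination -(q 0 - p 0) * h

lemma cross_ne_zero_of_affineIndependent {p q r : Plane} (h : AffineIndependent ℝ ![p, q, r]) :
    cross p q r ≠ 0 := by
  intro h0
  have hpq : p ≠ q := by simpa using h.injective.ne (by decide : (0 : Fin 3) ≠ 1)
  obtain ⟨t, rfl⟩ := exists_lineMap_of_cross_eq_zero hpq h0
  rw [affineIndependent_iff_not_collinear_set] at h
  refine h ?_
  have := collinear_insert_of_mem_affineSpan_pair (AffineMap.lineMap_mem_affineSpan_pair t p q)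
  rwa [Set.insert_comm, Set.pair_comm] at this

/-- An affine function vanishing at two distinct points is a multiple of `cross`. -/
lemma exists_eq_mul_cross (f : Plane →ᵃ[ℝ] ℝ) {u w : Plane} (huw : u ≠ w) (hu : f u = 0)
    (hw : f w = 0) : ∃ c : ℝ, ∀ y, f y = c * cross u w y := by
  have hpos := coord_sub_sq_pos huw
  obtain ⟨α, β, hf⟩ : ∃ α β : ℝ, ∀ y, f y = α * (y 0 - u 0) + β * (y 1 - u 1) := by
    refine ⟨f.linear (EuclideanSpace.single 0 1), f.linear (EuclideanSpace.single 1 1),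
      fun y => ?_⟩
    have h1 : f y = f.linear (y - u) := by
      rw [← vsub_eq_sub, f.linearMap_vsub, hu, vsub_eq_sub, sub_zero]
    have h2 : y - u = (y 0 - u 0) • (EuclideanSpace.single 0 1 : Plane) +
        (y 1 - u 1) • (EuclideanSpace.single 1 1 : Plane) := by
      ext i; fin_cases i <;> simp
    rw [h1, h2, map_add, map_smul, map_smul, smul_eq_mul, smul_eq_mul]
    ring
  have hw' := hf w
  rw [hw] at hw'
  -- Since `f w = 0`, the gradient `(α, β)` is perpendicular to `w - u`; `c` is its coefficient
  -- along `w - u` turned by a right angle.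
  refine ⟨(β * (w 0 - u 0) - α * (w 1 - u 1)) / ((w 0 - u 0) ^ 2 + (w 1 - u 1) ^ 2),
    fun y => ?_⟩
  rw [hf, div_mul_eq_mul_div, eq_div_iff hpos.ne']
  simp only [cross]
  linear_combination ((w 0 - u 0) * (y 0 - u 0) + (w 1 - u 1) * (y 1 - u 1)) * (-hw')

lemma tendsto_add_smul_nhdsGT (x d : Plane) :
    Tendsto (fun t : ℝ => x + t • d) (𝓝[>] 0) (𝓝 x) := by
  have : Tendsto (fun t : ℝ => x + t • d) (𝓝 0) (𝓝 (x + (0 : ℝ) • d)) :=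
    Continuous.tendsto (by fun_prop) 0
  rw [zero_smul, add_zero] at this
  exact this.mono_left nhdsWithin_le_nhds

lemma frequently_cross_pos {u w x : Plane} (huw : u ≠ w) (hx : cross u w x = 0) :
    ∃ᶠ y in 𝓝 x, 0 < cross u w y := by
  have hpos := coord_sub_sq_pos huw
  -- The direction is `w - u` turned by a right angle, along which `cross u w` grows at the rate of
  -- the squared length of `w - u`.
  refine (tendsto_add_smul_nhdsGT x !₂[-(w 1 - u 1), w 0 - u 0]).frequently
    (Eventually.frequently ?_)
  filter_upwards [self_mem_nhdsWithin] with t ht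
  have : cross u w (x + t • !₂[-(w 1 - u 1), w 0 - u 0]) =
      cross u w x + t * ((w 0 - u 0) ^ 2 + (w 1 - u 1) ^ 2) := by
    simp [cross]; ring
  rw [this, hx, zero_add]
  exact mul_pos ht hpos

lemma frequently_cross_neg {u w x : Plane} (huw : u ≠ w) (hx : cross u w x = 0) :
    ∃ᶠ y in 𝓝 x, cross u w y < 0 := by
  have := frequently_cross_pos huw.symm (x := x) (by rw [cross_swap, hx, neg_zero])
  refine this.mono fun y hy => ?_
  rw [cross_swap] at hy
  linarith

lemma cross_eq_zero_of_mem_segment {u w x : Plane} (hx : x ∈ segment ℝ u w) :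
    cross u w x = 0 := by
  rw [segment_eq_image_lineMap] at hx
  obtain ⟨t, -, rfl⟩ := hx
  rw [cross_lineMap, cross_left, cross_right, mul_zero, mul_zero, add_zero]

/-! ### Generic points of elementary segments -/

/-- An open interval that meets `[0, 1]` but avoids both 0 and 1 cannot leave `[0, 1]`. This is the
one-dimensional form of the next lemma, with the line through `p` and `q` parametrized so that they
sit at 0 and 1. -/
lemma mem_Icc_of_mem_openSegment {r s m : ℝ} (hm : m ∈ openSegment ℝ r s)
    (hm' : m ∈ Set.Icc (0 : ℝ) 1) (h0 : (0 : ℝ) ∉ openSegment ℝ r s)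
    (h1 : (1 : ℝ) ∉ openSegment ℝ r s) : r ∈ Set.Icc (0 : ℝ) 1 := by
  rcases lt_trichotomy r s with h | rfl | h
  · rw [openSegment_eq_Ioo h] at *
    refine ⟨?_, hm.1.le.trans hm'.2⟩
    by_contra! hr
    exact h0 ⟨hr, hm'.1.trans_lt hm.2⟩
  · rw [openSegment_same] at hm
    rwa [← Set.mem_singleton_iff.1 hm]
  · rw [openSegment_symm, openSegment_eq_Ioo h] at *
    refine ⟨hm'.1.trans hm.2.le, ?_⟩
    by_contra! hr
    exact h1 ⟨hm.1.trans_le hm'.2, hr⟩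

lemma mem_segment_of_cross_eq_zero {p q u w x : Plane} (hpq : p ≠ q) (hu : cross p q u = 0)
    (hw : cross p q w = 0) (hx : x ∈ segment ℝ p q) (hx' : x ∈ openSegment ℝ u w)
    (hp : p ∉ openSegment ℝ u w) (hq : q ∉ openSegment ℝ u w) : u ∈ segment ℝ p q := by
  obtain ⟨r, rfl⟩ := exists_lineMap_of_cross_eq_zero hpq hu
  obtain ⟨s, rfl⟩ := exists_lineMap_of_cross_eq_zero hpq hw
  rw [segment_eq_image_lineMap] at hx ⊢
  rw [← image_openSegment] at hx' hp hq
  obtain ⟨m, hm, rfl⟩ := hx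
  obtain ⟨m', hm', h⟩ := hx'
  obtain rfl : m' = m := AffineMap.lineMap_injective ℝ hpq h
  refine Set.mem_image_of_mem _ (mem_Icc_of_mem_openSegment hm' hm (fun h0 => ?_) fun h1 => ?_)
  · exact hp ⟨0, h0, AffineMap.lineMap_apply_zero _ _⟩
  · exact hq ⟨1, h1, AffineMap.lineMap_apply_one _ _⟩

lemma notMem_openSegment_of_mem_elementaryPairs {N : Finset Plane} {e : Plane × Plane}
    (he : e ∈ elementaryPairs N) {w : Plane} (hw : w ∈ N) : w ∉ openSegment ℝ e.1 e.2 := by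
  intro hws
  have hne := ne_of_mem_elementaryPairs he
  rcases (mem_elementaryPairs.1 he).2.2 w hw (openSegment_subset_segment ℝ _ _ hws) with h | h
  · rw [h, left_mem_openSegment_iff] at hws
    exact hne hws
  · rw [h, right_mem_openSegment_iff] at hws
    exact hne hws

/-- An elementary segment has a point that lies on a given finite family of segments only where
they contain the whole elementary segment. -/
lemma exists_generic_point {N : Finset Plane} {e : Plane × Plane} (he : e ∈ elementaryPairs N)
    {ι : Type*} [Finite ι] (p q : ι → Plane) (hp : ∀ i, p i ∈ N) (hq : ∀ i, q i ∈ N)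
    (hpq : ∀ i, p i ≠ q i) :
    ∃ x ∈ openSegment ℝ e.1 e.2, ∀ i,
      x ∈ segment ℝ (p i) (q i) ↔ e.1 ∈ segment ℝ (p i) (q i) ∧ e.2 ∈ segment ℝ (p i) (q i) := by
  -- The bad parameters are the transversal crossings with the line of segment `i`. An affine
  -- function of `t` with two zeros vanishes identically, so each line gives at most one.
  let bad : ι → Set ℝ := fun i => {t | cross (p i) (q i) (AffineMap.lineMap e.1 e.2 t) = 0 ∧
    ¬ (cross (p i) (q i) e.1 = 0 ∧ cross (p i) (q i) e.2 = 0)}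
  have hbad : ∀ i, (bad i).Finite := by
    intro i
    refine Set.Subsingleton.finite ?_
    rintro s ⟨hs, h⟩ t ⟨ht, -⟩
    by_contra hst
    rw [cross_lineMap] at hs ht
    have h3 : (s - t) * (cross (p i) (q i) e.2 - cross (p i) (q i) e.1) = 0 := by
      linear_combination hs - ht
    have h4 := (mul_eq_zero.1 h3).resolve_left (sub_ne_zero.2 hst)
    refine h ⟨by linear_combination hs - s * h4, by linear_combination hs + (1 - s) * h4⟩
  obtain ⟨t, ht, htbad⟩ := ((Set.Ioo_infinite (zero_lt_one (α := ℝ))).sdiff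
    (Set.finite_iUnion hbad)).nonempty
  have hx : AffineMap.lineMap e.1 e.2 t ∈ openSegment ℝ e.1 e.2 := by
    rw [openSegment_eq_image_lineMap]
    exact Set.mem_image_of_mem _ ht
  refine ⟨AffineMap.lineMap e.1 e.2 t, hx, fun i => ⟨fun hxi => ?_, fun h =>
    (convex_segment _ _).segment_subset h.1 h.2 (openSegment_subset_segment ℝ _ _ hx)⟩⟩
  have h0 := cross_eq_zero_of_mem_segment hxi
  obtain ⟨h1, h2⟩ : cross (p i) (q i) e.1 = 0 ∧ cross (p i) (q i) e.2 = 0 := by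
    by_contra h
    exact htbad (Set.mem_iUnion.2 ⟨i, h0, h⟩)
  -- All points are now collinear, and the ends of segment `i`, being in `N`, do not lie inside the
  -- elementary segment, which therefore cannot stick out of segment `i`.
  have hpo := notMem_openSegment_of_mem_elementaryPairs he (hp i)
  have hqo := notMem_openSegment_of_mem_elementaryPairs he (hq i)
  refine ⟨mem_segment_of_cross_eq_zero (hpq i) h1 h2 hxi hx hpo hqo, ?_⟩
  rw [openSegment_symm] at hx hpo hqo
  exact mem_segment_of_cross_eq_zero (hpq i) h2 h1 hxi hx hpo hqo

/-! ### The local structure of a triangle -/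

section Triangle

variable (T : Affine.Triangle ℝ Plane)

/-- The closed region bounded by a triangle. -/
abbrev region : Set Plane := convexHull ℝ (Set.range T.points)

/-- The side of a triangle opposite to the corner `a`. -/
abbrev side (a : Fin 3) : Set Plane := segment ℝ (T.points (a + 1)) (T.points (a + 2))

/-- The corners of a triangle as an affine basis of the plane. -/
noncomputable def cornerBasis : AffineBasis (Fin 3) ℝ Plane :=
  ⟨T.points, T.independent, by
    rw [T.independent.affineSpan_eq_top_iff_card_eq_finrank_add_one]
    simp⟩

/-- The barycentric coordinate of a triangle belonging to the corner `a`. -/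
noncomputable abbrev bary (a : Fin 3) : Plane →ᵃ[ℝ] ℝ := (cornerBasis T).coord a

variable {T}

lemma mem_region_iff {y : Plane} : y ∈ region T ↔ ∀ a, 0 ≤ bary T a y := by
  have := (cornerBasis T).convexHull_eq_nonneg_coord
  exact Set.ext_iff.1 this y

lemma mem_interior_region_iff {y : Plane} :
    y ∈ interior (region T) ↔ ∀ a, 0 < bary T a y := by
  have := (cornerBasis T).interior_convexHull
  exact Set.ext_iff.1 this y

lemma bary_points_self (a : Fin 3) : bary T a (T.points a) = 1 :=
  (cornerBasis T).coord_apply_eq a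

lemma bary_points_of_ne {a b : Fin 3} (h : a ≠ b) : bary T a (T.points b) = 0 :=
  (cornerBasis T).coord_apply_ne h

lemma points_ne_of_ne {a b : Fin 3} (h : a ≠ b) : T.points a ≠ T.points b :=
  T.independent.injective.ne h

lemma mem_side_iff {a : Fin 3} {y : Plane} : y ∈ side T a ↔ y ∈ region T ∧ bary T a y = 0 := by
  constructor
  · intro hy
    refine ⟨segment_subset_convexHull (Set.mem_range_self _) (Set.mem_range_self _) hy, ?_⟩
    rw [side, segment_eq_image_lineMap] at hy
    obtain ⟨t, -, rfl⟩ := hy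
    rw [AffineMap.apply_lineMap, bary_points_of_ne (by fin_cases a <;> decide),
      bary_points_of_ne (by fin_cases a <;> decide)]
    simp
  · rintro ⟨hy, ha⟩
    rw [mem_region_iff] at hy
    have hsum := (cornerBasis T).sum_coord_apply_eq_one y
    have hcomb := (cornerBasis T).linear_combination_coord_eq_self y
    have hre : ∀ {M : Type} [AddCommMonoid M] (f : Fin 3 → M),
        ∑ b, f b = f a + f (a + 1) + f (a + 2) := by
      intro M _ f
      rw [Fin.sum_univ_three]
      fin_cases a
      · rfl
      · change _ = f 1 + f 2 + f 0
        abel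
      · change _ = f 2 + f 0 + f 1
        abel
    rw [hre] at hsum hcomb
    rw [ha, zero_add] at hsum
    rw [ha, zero_smul, zero_add] at hcomb
    exact ⟨_, _, hy _, hy _, hsum, hcomb⟩

lemma eventually_bary_pos {x : Plane} {b : Fin 3} (h : 0 < bary T b x) :
    ∀ᶠ y in 𝓝 x, 0 < bary T b y :=
  (continuous_barycentric_coord (cornerBasis T) b).continuousAt.eventually (lt_mem_nhds h)

/-- Near a point that is not a corner, a triangle is everything, or nothing, or a half-plane
bounded by the line of a side. -/
lemma region_local {x : Plane} (hx : ∀ a, x ≠ T.points a) :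
    (∀ᶠ y in 𝓝 x, y ∈ interior (region T)) ∨ (∀ᶠ y in 𝓝 x, y ∉ region T) ∨
      ∃ a, bary T a x = 0 ∧ (∀ b ≠ a, 0 < bary T b x) ∧
        ∀ᶠ y in 𝓝 x, (y ∈ region T ↔ 0 ≤ bary T a y) ∧
          (y ∈ interior (region T) ↔ 0 < bary T a y) := by
  by_cases hmem : x ∈ region T
  · by_cases hint : x ∈ interior (region T)
    · exact Or.inl (isOpen_interior.mem_nhds hint)
    · refine Or.inr (Or.inr ?_)
      rw [mem_region_iff] at hmem
      rw [mem_interior_region_iff] at hint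
      push Not at hint
      obtain ⟨a, ha⟩ := hint
      have ha0 : bary T a x = 0 := le_antisymm ha (hmem a)
      have hpos : ∀ b ≠ a, 0 < bary T b x := by
        intro b hb
        refine lt_of_le_of_ne (hmem b) fun hb0 => ?_
        -- If two barycentric coordinates vanished, `x` would be the third corner `c`.
        obtain ⟨c, hc⟩ : ∃ c, ∀ d, d ≠ c → d = a ∨ d = b := by
          clear * - hb
          decide +revert
        refine hx c ?_
        refine (cornerBasis T).ext_elem fun d => ?_
        have hd0 : ∀ d, d ≠ c → (cornerBasis T).coord d x = 0 := by
          intro d hd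
          rcases hc d hd with rfl | rfl
          · exact ha0
          · exact hb0.symm
        by_cases hd : d = c
        · subst hd
          rw [bary_points_self]
          have hsum := (cornerBasis T).sum_coord_apply_eq_one x
          rwa [Finset.sum_eq_single_of_mem d (Finset.mem_univ _) fun d' _ h => hd0 d' h] at hsum
        · rw [hd0 d hd, bary_points_of_ne hd]
      refine ⟨a, ha0, hpos, ?_⟩
      have hev : ∀ᶠ y in 𝓝 x, ∀ b, b ≠ a → 0 < bary T b y :=
        eventually_all.2 fun b => by
          by_cases hb : b = a
          · simp [hb]
          · filter_upwards [eventually_bary_pos (hpos b hb)] with y hy _ using hy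
      filter_upwards [hev] with y hy
      rw [mem_region_iff, mem_interior_region_iff]
      refine ⟨⟨fun h => h a, fun h b => ?_⟩, ⟨fun h => h a, fun h b => ?_⟩⟩ <;>
        by_cases hb : b = a
      · rwa [hb]
      · exact (hy b hb).le
      · rwa [hb]
      · exact hy b hb
  · refine Or.inr (Or.inl ?_)
    exact ((Set.finite_range T.points).isClosed_convexHull ℝ).isOpen_compl.mem_nhds hmem

open Classical in
/-- Near a generic point of an elementary segment, a triangle is determined by whether it
contains the two half-discs cut out by the segment, and the number of its sides that contain the
segment is the number of these half-discs modulo 2. -/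
lemma region_local_generic {u w x : Plane} (huw : u ≠ w) (hxc : ∀ a, x ≠ T.points a)
    (hx : ∀ a, x ∈ side T a ↔ u ∈ side T a ∧ w ∈ side T a) :
    ∃ A B : Prop,
      (∀ᶠ y in 𝓝 x,
        (0 < cross u w y → (y ∈ region T ↔ A) ∧ (y ∈ interior (region T) ↔ A)) ∧
        (cross u w y < 0 → (y ∈ region T ↔ B) ∧ (y ∈ interior (region T) ↔ B)) ∧
        (cross u w y = 0 → (y ∈ region T ↔ A ∨ B))) ∧
      (∑ a, if u ∈ side T a ∧ w ∈ side T a then (1 : ZMod 2) else 0) =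
        (if A then 1 else 0) + (if B then 1 else 0) := by
  rcases region_local hxc with h | h | ⟨a, ha, hpos, h⟩
  · refine ⟨True, True, ?_, ?_⟩
    · filter_upwards [h] with y hy
      have := interior_subset hy
      tauto
    · have h0 := mem_interior_region_iff.1 h.self_of_nhds
      rw [if_pos trivial, CharTwo.add_self_eq_zero]
      refine Finset.sum_eq_zero fun b _ => if_neg fun hb => ?_
      exact (h0 b).ne' (mem_side_iff.1 ((hx b).2 hb)).2
  · refine ⟨False, False, ?_, ?_⟩
    · filter_upwards [h] with y hy
      have : y ∉ interior (region T) := fun h => hy (interior_subset h)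
      tauto
    · rw [if_neg not_false, add_zero]
      refine Finset.sum_eq_zero fun b _ => if_neg fun hb => ?_
      exact h.self_of_nhds (mem_side_iff.1 ((hx b).2 hb)).1
  · have hxa : x ∈ side T a := mem_side_iff.2 ⟨(h.self_of_nhds.1).2 ha.ge, ha⟩
    have huwa := (hx a).1 hxa
    obtain ⟨c, hc⟩ := exists_eq_mul_cross (bary T a) huw (mem_side_iff.1 huwa.1).2
      (mem_side_iff.1 huwa.2).2
    have hc0 : c ≠ 0 := by
      rintro rfl
      have := hc (T.points a)
      rw [bary_points_self, zero_mul] at this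
      exact one_ne_zero this
    -- The sign of `c` tells on which side of the line through `u` and `w` the triangle lies.
    refine ⟨0 < c, c < 0, ?_, ?_⟩
    · filter_upwards [h] with y ⟨hy, hy'⟩
      rw [hy, hy', hc]
      refine ⟨fun hl => ?_, fun hl => ?_, fun hl => ?_⟩
      · rw [mul_nonneg_iff_of_pos_right hl, mul_pos_iff_of_pos_right hl]
        exact ⟨⟨fun h => lt_of_le_of_ne h hc0.symm, le_of_lt⟩, Iff.rfl⟩
      · have : ∀ z : ℝ, c * z = -c * -z := fun z => by ring
        rw [this, mul_nonneg_iff_of_pos_right (neg_pos.2 hl),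
          mul_pos_iff_of_pos_right (neg_pos.2 hl), neg_nonneg, neg_pos]
        exact ⟨⟨fun h => lt_of_le_of_ne h hc0, le_of_lt⟩, Iff.rfl⟩
      · rw [hl, mul_zero]
        simpa using hc0.symm.lt_or_gt
    · rw [Finset.sum_eq_single_of_mem a (Finset.mem_univ _), if_pos huwa]
      · rcases hc0.lt_or_gt with h | h
        · rw [if_neg h.not_gt, if_pos h, zero_add]
        · rw [if_pos h, if_neg h.not_gt, add_zero]
      · intro b _ hb
        refine if_neg fun h => ?_
        exact (hpos b hb).ne' (mem_side_iff.1 ((hx b).2 h)).2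

end Triangle

/-! ### Dissections of simple polygons -/

namespace IsSimplePolygon

variable {k : ℕ} [NeZero k] {P : Set Plane} {B : Polygon Plane k}

lemma mem_frontier_iff (hP : IsSimplePolygon P B) {x : Plane} :
    x ∈ frontier P ↔ ∃ j, x ∈ segment ℝ (B j) (B (finRotate k j)) := by
  rw [hP.frontier_eq, Polygon.boundary, Set.mem_iUnion]
  simp only [Polygon.edgeSet, affineSegment_eq_segment]

/-- Away from the corners the half-open edges, which are disjoint, contain everything the closed
edges do. -/
lemma eq_of_mem_segment (hP : IsSimplePolygon P B) {x : Plane} (hx : ∀ j, x ≠ B j) {i j : Fin k}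
    (hi : x ∈ segment ℝ (B i) (B (finRotate k i)))
    (hj : x ∈ segment ℝ (B j) (B (finRotate k j))) : i = j := by
  have key : ∀ {l}, x ∈ segment ℝ (B l) (B (finRotate k l)) →
      x ∈ B.edgePath ℝ l '' Set.Ico (0 : ℝ) 1 := by
    intro l hl
    rw [segment_eq_image_lineMap] at hl
    obtain ⟨t, ⟨ht0, ht1⟩, rfl⟩ := hl
    refine ⟨t, ⟨ht0, lt_of_le_of_ne ht1 ?_⟩, rfl⟩
    rintro rfl
    exact hx _ (AffineMap.lineMap_apply_one _ _)
  by_contra hij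
  exact (Set.disjoint_left.1 (hP.simple hij)) (key hi) (key hj)

end IsSimplePolygon

namespace Dissection

variable {P : Set Plane} {n : ℕ} (D : Dissection P n)

lemma region_subset (i : Fin n) : region (D.triangle i) ⊆ P := by
  conv_rhs => rw [← D.cover]
  exact Set.subset_iUnion (fun i => region (D.triangle i)) i

lemma exists_mem_region {y : Plane} (hy : y ∈ P) : ∃ i, y ∈ region (D.triangle i) := by
  rw [← D.cover] at hy
  exact Set.mem_iUnion.1 hy

lemma mem_iff {y : Plane} : y ∈ P ↔ ∃ i, y ∈ region (D.triangle i) :=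
  ⟨D.exists_mem_region, fun ⟨i, hi⟩ => D.region_subset i hi⟩

lemma eq_of_mem_interior {y : Plane} {i j : Fin n} (hi : y ∈ interior (region (D.triangle i)))
    (hj : y ∈ interior (region (D.triangle j))) : i = j := by
  by_contra hij
  exact Set.disjoint_left.1 (D.disjoint_interiors hij) hi hj

lemma points_mem_nodes (i : Fin n) (a : Fin 3) : (D.triangle i).points a ∈ D.nodes :=
  (D.corner i a).2

lemma finite_nodes : D.nodes.Finite :=
  Set.finite_iUnion fun _ => Set.finite_range _

/-- A boundary segment issuing from a point that is not a node runs along a side of a triangle. -/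
lemma exists_bary_eq_zero {c e : Plane} (hc : c ∉ D.nodes)
    (hce : segment ℝ c e ⊆ frontier P) (hP : IsClosed P) :
    ∃ i a, bary (D.triangle i) a c = 0 ∧ bary (D.triangle i) a e = 0 ∧
      (∀ b ≠ a, 0 < bary (D.triangle i) b c) ∧
      ∀ᶠ y in 𝓝 c, 0 < bary (D.triangle i) a y → y ∈ interior (region (D.triangle i)) := by
  have hne : ∀ i a, c ≠ (D.triangle i).points a := by
    rintro i a rfl
    exact hc (D.points_mem_nodes i a)
  have hstep : ∀ i, ∀ᶠ y in 𝓝 c, y ∈ region (D.triangle i) →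
      y ∉ interior (region (D.triangle i)) → ∃ a, bary (D.triangle i) a c = 0 ∧
        bary (D.triangle i) a y = 0 ∧ (∀ b ≠ a, 0 < bary (D.triangle i) b c) ∧
        ∀ᶠ y in 𝓝 c, 0 < bary (D.triangle i) a y → y ∈ interior (region (D.triangle i)) := by
    intro i
    rcases region_local (hne i) with h | h | ⟨a, ha, hpos, h⟩
    · filter_upwards [h] with y hy _ hy' using absurd hy hy'
    · filter_upwards [h] with y hy hy' using absurd hy' hy
    · have h' : ∀ᶠ y in 𝓝 c, 0 < bary (D.triangle i) a y →
          y ∈ interior (region (D.triangle i)) := by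
        filter_upwards [h] with y hy using hy.2.2
      filter_upwards [h] with y hy h1 h2
      exact ⟨a, ha, le_antisymm (not_lt.1 fun h => h2 (hy.2.2 h)) (hy.1.1 h1), hpos, h'⟩
  -- There are finitely many triangles, so one point close to `c` on the segment serves for all. It
  -- lies on the boundary of `P`, hence in some triangle but not in its interior; a coordinate
  -- vanishing there and at `c` vanishes at `e` too.
  have hall := (tendsto_add_smul_nhdsGT c (e - c)).eventually (eventually_all.2 hstep)
  obtain ⟨t, ht, ht0, ht1⟩ := (hall.and (Ioo_mem_nhdsGT (zero_lt_one (α := ℝ)))).exists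
  have hy : c + t • (e - c) = AffineMap.lineMap c e t := by
    rw [AffineMap.lineMap_apply, vadd_eq_add, vsub_eq_sub, add_comm]
  rw [hy] at ht
  have hfr : AffineMap.lineMap c e t ∈ frontier P := by
    refine hce ?_
    rw [segment_eq_image_lineMap]
    exact Set.mem_image_of_mem _ ⟨ht0.le, ht1.le⟩
  obtain ⟨i, hi⟩ := D.exists_mem_region (hP.frontier_subset hfr)
  obtain ⟨a, h1, h2, h3, h4⟩ := ht i hi fun h =>
    hfr.2 (interior_mono (D.region_subset i) h)
  refine ⟨i, a, h1, ?_, h3, h4⟩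
  rw [AffineMap.apply_lineMap, h1, AffineMap.lineMap_apply, vsub_eq_sub, sub_zero, vadd_eq_add,
    add_zero, smul_eq_mul] at h2
  exact (mul_eq_zero.1 h2).resolve_left ht0.ne'

/-- At a point that is not a node, each of the two boundary directions would border a triangle that
fills a half-disc. Half-discs with different bounding lines overlap, so by disjointness of interiors
the triangles coincide, and so do their sides through `c`; that side would then contain two
different directions. -/
lemma mem_nodes_of_segment_subset_frontier {c e e' : Plane} (hP : IsClosed P)
    (he : segment ℝ c e ⊆ frontier P) (he' : segment ℝ c e' ⊆ frontier P)
    (h : cross c e e' ≠ 0) : c ∈ D.nodes := by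
  by_contra hc
  obtain ⟨i, a, h1, h2, h3, h4⟩ := D.exists_bary_eq_zero hc he hP
  obtain ⟨i', a', h1', h2', h3', h4'⟩ := D.exists_bary_eq_zero hc he' hP
  have hce : c ≠ e := by rintro rfl; simp [cross] at h
  have hce' : c ≠ e' := by rintro rfl; simp [cross] at h
  obtain ⟨r, hr⟩ := exists_eq_mul_cross _ hce h1 h2
  obtain ⟨r', hr'⟩ := exists_eq_mul_cross _ hce' h1' h2'
  have hr0 : r ≠ 0 := by
    rintro rfl
    have := hr ((D.triangle i).points a)
    rw [bary_points_self, zero_mul] at this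
    exact one_ne_zero this
  have hr0' : r' ≠ 0 := by
    rintro rfl
    have := hr' ((D.triangle i').points a')
    rw [bary_points_self, zero_mul] at this
    exact one_ne_zero this
  -- The coefficients make both barycentric coordinates equal to `t` times a nonzero square, so the
  -- point lies in both open half-planes.
  have hev := (tendsto_add_smul_nhdsGT c ((-(r' * cross c e e')) • (e - c) +
    (r * cross c e e') • (e' - c))).eventually (h4.and h4')
  obtain ⟨t, ⟨hy, hy'⟩, ht : 0 < t⟩ := (hev.and self_mem_nhdsWithin).exists
  set y := c + t • ((-(r' * cross c e e')) • (e - c) + (r * cross c e e') • (e' - c)) with hydef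
  have e1 : cross c e y = t * (r * cross c e e') * cross c e e' := by
    simp [hydef, cross]; ring
  have e2 : cross c e' y = t * (r' * cross c e e') * cross c e e' := by
    simp [hydef, cross]; ring
  have p1 : 0 < bary (D.triangle i) a y := by
    rw [hr, e1, show r * (t * (r * cross c e e') * cross c e e') =
      t * (r * cross c e e') ^ 2 by ring]
    positivity
  have p2 : 0 < bary (D.triangle i') a' y := by
    rw [hr', e2, show r' * (t * (r' * cross c e e') * cross c e e') =
      t * (r' * cross c e e') ^ 2 by ring]
    positivity
  obtain rfl := D.eq_of_mem_interior (hy p1) (hy' p2)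
  have haa : a = a' := by
    by_contra hne
    exact (h3' a hne).ne' h1
  subst haa
  have := hr e'
  rw [h2'] at this
  exact mul_ne_zero hr0 h this.symm

lemma vertices_mem_nodes {k : ℕ} [NeZero k] {B : Polygon Plane k} (hP : IsSimplePolygon P B)
    (j : Fin k) : B j ∈ D.nodes := by
  have hnd := cross_ne_zero_of_affineIndependent (hP.corners (j - 1))
  have h1 : j - 1 + 1 = j := sub_add_cancel j 1
  have h2 : j - 1 + 2 = j + 1 := by
    -- The numeral 2 is taken modulo `k`.
    have h3 : (2 : Fin k) = 1 + 1 := Fin.ext (Nat.add_mod 1 1 k)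
    rw [h3, ← add_assoc, h1]
  rw [h1, h2] at hnd
  refine D.mem_nodes_of_segment_subset_frontier hP.isCompact.isClosed (e := B (j - 1))
    (e' := B (j + 1)) (fun x hx => hP.mem_frontier_iff.2 ⟨j - 1, ?_⟩)
    (fun x hx => hP.mem_frontier_iff.2 ⟨j, ?_⟩) (by rwa [cross_swap, neg_ne_zero])
  · rwa [finRotate_apply, h1, segment_symm]
  · rwa [finRotate_apply]

/-! ### Double counting of edges on sides of faces, modulo 2 -/

/-- The nodes of the skeleton graph as a finite set of points. -/
noncomputable def nodeFinset : Finset Plane := D.finite_nodes.toFinset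

variable {D} in
lemma mem_nodeFinset {x : Plane} : x ∈ D.nodeFinset ↔ x ∈ D.nodes :=
  D.finite_nodes.mem_toFinset

open Classical in
/-- Every elementary segment lies on an even number of sides of faces, the outside face
included. -/
lemma sum_sides_eq_sum_edges {k : ℕ} [NeZero k] {B : Polygon Plane k} (hP : IsSimplePolygon P B)
    {e : Plane × Plane} (he : e ∈ elementaryPairs D.nodeFinset) :
    (∑ i, ∑ a, if e.1 ∈ side (D.triangle i) a ∧ e.2 ∈ side (D.triangle i) a
      then (1 : ZMod 2) else 0) =
    ∑ j, if e.1 ∈ segment ℝ (B j) (B (finRotate k j)) ∧ e.2 ∈ segment ℝ (B j) (B (finRotate k j))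
      then 1 else 0 := by
  have hne := ne_of_mem_elementaryPairs he
  obtain ⟨x, hx, hgen⟩ := exists_generic_point he (ι := (Fin n × Fin 3) ⊕ Fin k)
    (Sum.elim (fun s => (D.triangle s.1).points (s.2 + 1)) fun j => B j)
    (Sum.elim (fun s => (D.triangle s.1).points (s.2 + 2)) fun j => B (finRotate k j))
    (by
      rintro (s | j) <;> rw [mem_nodeFinset]
      exacts [D.points_mem_nodes _ _, D.vertices_mem_nodes hP _])
    (by
      rintro (s | j) <;> rw [mem_nodeFinset]
      exacts [D.points_mem_nodes _ _, D.vertices_mem_nodes hP _])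
    (by
      rintro (⟨i, a⟩ | j)
      · exact points_ne_of_ne ((by decide : ∀ a : Fin 3, a + 1 ≠ a + 2) a)
      · exact hP.corners.hasNondegenerateEdges j)
  have hxN : ∀ w ∈ D.nodes, x ≠ w := by
    rintro w hw rfl
    exact notMem_openSegment_of_mem_elementaryPairs he (mem_nodeFinset.2 hw) hx
  have hside : ∀ i a, x ∈ side (D.triangle i) a ↔
      e.1 ∈ side (D.triangle i) a ∧ e.2 ∈ side (D.triangle i) a := fun i a => hgen (Sum.inl (i, a))
  have hedge : ∀ j, x ∈ segment ℝ (B j) (B (finRotate k j)) ↔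
      e.1 ∈ segment ℝ (B j) (B (finRotate k j)) ∧ e.2 ∈ segment ℝ (B j) (B (finRotate k j)) :=
    fun j => hgen (Sum.inr j)
  -- `L i` and `R i` say that triangle `i` fills the half-disc at `x` where `cross e.1 e.2` is
  -- positive, respectively negative. Each half-disc is filled by at most one triangle.
  choose L R hloc hsum using fun i =>
    region_local_generic hne (fun a => hxN _ (D.points_mem_nodes i a)) (hside i)
  have hx0 := cross_eq_zero_of_mem_segment (openSegment_subset_segment ℝ _ _ hx)
  have hpos := frequently_cross_pos hne hx0
  have hneg := frequently_cross_neg hne hx0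
  have hall := eventually_all.2 hloc
  have huniq : ∀ {Q : Fin n → Prop}, (∀ i j, Q i → Q j → i = j) →
      ∑ i, (if Q i then (1 : ZMod 2) else 0) = if ∃ i, Q i then 1 else 0 := by
    intro Q hQ
    split_ifs with h
    · obtain ⟨i, hi⟩ := h
      rw [Finset.sum_eq_single_of_mem i (Finset.mem_univ _), if_pos hi]
      exact fun j _ hj => if_neg fun h => hj (hQ j i h hi)
    · exact Finset.sum_eq_zero fun i _ => if_neg fun hi => h ⟨i, hi⟩
  have hL : ∀ i j, L i → L j → i = j := by
    intro i j hi hj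
    obtain ⟨y, hy, hloc⟩ := (hpos.and_eventually hall).exists
    exact D.eq_of_mem_interior (((hloc i).1 hy).2.2 hi) (((hloc j).1 hy).2.2 hj)
  have hR : ∀ i j, R i → R j → i = j := by
    intro i j hi hj
    obtain ⟨y, hy, hloc⟩ := (hneg.and_eventually hall).exists
    exact D.eq_of_mem_interior (((hloc i).2.1 hy).2.2 hi) (((hloc j).2.1 hy).2.2 hj)
  have hPloc : ∀ᶠ y in 𝓝 x, (0 < cross e.1 e.2 y → (y ∈ P ↔ ∃ i, L i)) ∧
      (cross e.1 e.2 y < 0 → (y ∈ P ↔ ∃ i, R i)) ∧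
      (cross e.1 e.2 y = 0 → (y ∈ P ↔ (∃ i, L i) ∨ ∃ i, R i)) := by
    filter_upwards [hall] with y hy
    rw [D.mem_iff]
    refine ⟨fun h => exists_congr fun i => ((hy i).1 h).1,
      fun h => exists_congr fun i => ((hy i).2.1 h).1, fun h => ?_⟩
    rw [← exists_or]
    exact exists_congr fun i => (hy i).2.2 h
  -- A boundary point is one with exactly one of its two half-discs filled; with both or neither, a
  -- neighborhood of `x` lies inside or outside `P`.
  have hfr : x ∈ frontier P ↔ ¬ ((∃ i, L i) ↔ ∃ i, R i) := by
    by_cases hA : ∃ i, L i <;> by_cases hB : ∃ i, R i <;> simp only [hA, hB] at hPloc ⊢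
    · simp only [not_true_eq_false, iff_false]
      refine fun h => h.2 (mem_interior_iff_mem_nhds.2 ?_)
      filter_upwards [hPloc] with y hy
      rcases lt_trichotomy (cross e.1 e.2 y) 0 with h | h | h
      · exact (hy.2.1 h).2 trivial
      · exact (hy.2.2 h).2 (Or.inl trivial)
      · exact (hy.1 h).2 trivial
    · simp only [iff_false, not_true_eq_false, not_false_eq_true, iff_true]
      refine ⟨mem_closure_iff_frequently.2 ?_, fun h => ?_⟩
      · exact (hpos.and_eventually hPloc).mono fun y hy => (hy.2.1 hy.1).2 trivial
      · obtain ⟨y, ⟨hy, hy'⟩, hyP⟩ := ((hneg.and_eventually hPloc).and_eventually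
          (mem_interior_iff_mem_nhds.1 h)).exists
        exact (hy'.2.1 hy).1 hyP
    · simp only [not_false_eq_true, iff_true]
      refine ⟨mem_closure_iff_frequently.2 ?_, fun h => ?_⟩
      · exact (hneg.and_eventually hPloc).mono fun y hy => (hy.2.2.1 hy.1).2 trivial
      · obtain ⟨y, ⟨hy, hy'⟩, hyP⟩ := ((hpos.and_eventually hPloc).and_eventually
          (mem_interior_iff_mem_nhds.1 h)).exists
        exact (hy'.1 hy).1 hyP
    · simp only [not_true_eq_false, iff_false]
      intro h
      obtain ⟨y, hyP, hy⟩ := ((mem_closure_iff_frequently.1 h.1).and_eventually hPloc).exists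
      rcases lt_trichotomy (cross e.1 e.2 y) 0 with h | h | h
      · exact (hy.2.1 h).1 hyP
      · exact ((hy.2.2 h).1 hyP).elim id id
      · exact (hy.1 h).1 hyP
  have hedges : (∑ j, if e.1 ∈ segment ℝ (B j) (B (finRotate k j)) ∧
      e.2 ∈ segment ℝ (B j) (B (finRotate k j)) then (1 : ZMod 2) else 0) =
      if x ∈ frontier P then 1 else 0 := by
    simp only [← hedge]
    split_ifs with h
    · obtain ⟨j, hj⟩ := hP.mem_frontier_iff.1 h
      rw [Finset.sum_eq_single_of_mem j (Finset.mem_univ _), if_pos hj]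
      exact fun l _ hl => if_neg fun h =>
        hl (hP.eq_of_mem_segment (fun m => hxN _ (D.vertices_mem_nodes hP m)) h hj)
    · exact Finset.sum_eq_zero fun j _ => if_neg fun hj => h (hP.mem_frontier_iff.2 ⟨j, hj⟩)
  rw [hedges, Finset.sum_congr rfl fun i _ => hsum i, Finset.sum_add_distrib, huniq hL, huniq hR]
  simp only [hfr]
  by_cases hA : ∃ i, L i <;> by_cases hB : ∃ i, R i <;> simp [hA, hB, CharTwo.add_self_eq_zero]

/-- If a function of pairs of nodes is a coboundary modulo 2
along every side of every face, its sums over the triangular faces and over the outside face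
agree. -/
lemma sum_triangles_eq_sum_polygon {k : ℕ} [NeZero k] {B : Polygon Plane k}
    (hP : IsSimplePolygon P B) (f : Plane → Plane → ZMod 2)
    (hside : ∀ i a, ∃ g : Plane → ZMod 2, ∀ x ∈ D.nodes, ∀ y ∈ D.nodes,
      x ∈ side (D.triangle i) a → y ∈ side (D.triangle i) a → f x y = g x + g y)
    (hedge : ∀ j, ∃ g : Plane → ZMod 2, ∀ x ∈ D.nodes, ∀ y ∈ D.nodes,
      x ∈ segment ℝ (B j) (B (finRotate k j)) → y ∈ segment ℝ (B j) (B (finRotate k j)) →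
      f x y = g x + g y) :
    ∑ i, ∑ a, f ((D.triangle i).points (a + 1)) ((D.triangle i).points (a + 2)) =
      ∑ j, f (B j) (B (finRotate k j)) := by
  classical
  have key : ∀ {p q : Plane}, p ∈ D.nodes → q ∈ D.nodes →
      (∃ g : Plane → ZMod 2, ∀ x ∈ D.nodes, ∀ y ∈ D.nodes,
        x ∈ segment ℝ p q → y ∈ segment ℝ p q → f x y = g x + g y) →
      f p q = ∑ e ∈ elementaryPairs D.nodeFinset,
        f e.1 e.2 * if e.1 ∈ segment ℝ p q ∧ e.2 ∈ segment ℝ p q then 1 else 0 := by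
    rintro p q hp hq ⟨g, hg⟩
    rw [hg p hp q hq (left_mem_segment ℝ p q) (right_mem_segment ℝ p q),
      ← sum_elementaryPairs g (mem_nodeFinset.2 hp) (mem_nodeFinset.2 hq)]
    refine Finset.sum_congr rfl fun e he => ?_
    obtain ⟨⟨h1, h2⟩, -⟩ := mem_elementaryPairs.1 he
    split_ifs with h
    · rw [mul_one, hg _ (mem_nodeFinset.1 h1) _ (mem_nodeFinset.1 h2) h.1 h.2]
    · rw [mul_zero]
  have hl : ∀ i a, f ((D.triangle i).points (a + 1)) ((D.triangle i).points (a + 2)) = _ :=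
    fun i a => key (D.points_mem_nodes _ _) (D.points_mem_nodes _ _) (hside i a)
  have hr : ∀ j, f (B j) (B (finRotate k j)) = _ :=
    fun j => key (D.vertices_mem_nodes hP _) (D.vertices_mem_nodes hP _) (hedge j)
  simp only [hl, hr]
  -- Exchanging sums leaves, for each elementary pair, the number of sides containing it, and the
  -- two counts agree modulo 2.
  rw [Finset.sum_congr rfl fun i _ => Finset.sum_comm, Finset.sum_comm,
    Finset.sum_comm (s := Finset.univ (α := Fin k))]
  refine Finset.sum_congr rfl fun e he => ?_
  simp only [← Finset.mul_sum]
  rw [D.sum_sides_eq_sum_edges hP he]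

end Dissection

end FramedMonsky

/-! ### The parity argument for the framed map -/

open FramedMonsky in
theorem theorem3p9 (v : Valuation ℝ NNReal) (hv : FramedMonsky.IsTwoAdic v)
    {k : ℕ} [NeZero k] (P : Set FramedMonsky.Plane) (B : Polygon FramedMonsky.Plane k)
    (hP : FramedMonsky.IsSimplePolygon P B)
    (E : ℤ) (hE : MeasureTheory.volume.real P = (E : ℝ))
    (hodd : Odd {j : Fin k | FramedMonsky.IsRedBlueSide v B j}.ncard)
    (n : ℕ) (hn : Odd n) (D : FramedMonsky.Dissection P n)
    (φ : D.nodes → FramedMonsky.Plane) (hφ : D.IsConstrainedFramedMap B φ) :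
    ∃ i : Fin n, D.faceArea φ i ≠ (E : ℝ) / (n : ℝ) := by
  classical
  -- `ψ` extends `φ` to the plane; its values off the nodes play no role.
  let ψ : Plane → Plane := fun x => if h : x ∈ D.nodes then φ ⟨x, h⟩ else x
  have hψ : ∀ x (h : x ∈ D.nodes), ψ x = φ ⟨x, h⟩ := fun x h => dif_pos h
  let f : Plane → Plane → ZMod 2 := fun x y => redBlue (color v (ψ x)) (color v (ψ y))
  have hf : ∀ s : Set Plane, Collinear ℝ (φ '' D.nodesOn s) → ∃ g : Plane → ZMod 2,
      ∀ x ∈ D.nodes, ∀ y ∈ D.nodes, x ∈ s → y ∈ s → f x y = g x + g y := by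
    intro s hs
    obtain ⟨g, hg⟩ := exists_redBlue_eq_add (v := v) hs
    refine ⟨g ∘ ψ, fun x hx y hy hxs hys => hg _ ⟨⟨x, hx⟩, hxs, (hψ x hx).symm⟩ _
      ⟨⟨y, hy⟩, hys, (hψ y hy).symm⟩⟩
  have hsum := D.sum_triangles_eq_sum_polygon hP f
    (fun i a => hf _ (hφ.triangular_faces i (a + 1) (a + 2) (by fin_cases a <;> decide)))
    (fun j => hf _ (by
      rw [← affineSegment_eq_segment]
      exact hφ.outside_face j))
  have hfix : ∀ j, ψ (B j) = B j := fun j => by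
    rw [hψ _ (D.vertices_mem_nodes hP j)]
    exact hφ.framed _ ⟨j, rfl⟩
  have hright : ∑ j, f (B j) (B (finRotate k j)) = 1 := by
    have h1 : ∀ j, f (B j) (B (finRotate k j)) = if IsRedBlueSide v B j then 1 else 0 := by
      intro j
      simp only [f, hfix]
      split_ifs with h
      · rcases h with ⟨h, h'⟩ | ⟨h, h'⟩ <;> rw [h, h'] <;> rfl
      · unfold IsRedBlueSide at h
        revert h
        cases color v (B j) <;> cases color v (B (finRotate k j)) <;> simp [redBlue]
    rw [Finset.sum_congr rfl fun j _ => h1 j, Finset.sum_boole]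
    rw [Set.ncard_eq_toFinset_card'] at hodd
    simpa using (ZMod.natCast_eq_one_iff_odd).2 hodd
  rw [hright] at hsum
  -- The total over the faces is odd, so some face has an odd number of red-blue sides with respect
  -- to `φ`.
  obtain ⟨i, -, hi⟩ := Finset.exists_ne_zero_of_sum_ne_zero (hsum.trans_ne one_ne_zero)
  refine ⟨i, hv.signedArea_ne_of_rainbow hn ?_⟩
  have := rainbow_of_sum_redBlue_ne_zero (c := fun a => color v (ψ ((D.triangle i).points a))) hi
  intro c
  obtain ⟨a, ha⟩ := this c
  refine ⟨a, ?_⟩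
  dsimp only at ha
  rwa [hψ _ (D.points_mem_nodes i a)] at ha
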